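/- Let $n\ge 0$ and let $X=\{X_t\}_{t\ge 0}$ be a Lévy process on $\mathbb{R}^n$, i.e. $X_0=0$ a.s., $X$ has càdlàg paths a.s., and $X$ has stationary and independent increments. Let $(b,Q,\nu)$ be its characteristic triplet: $b\in\mathbb{R}^n$, $Q$ is a symmetric positive semidefinite $n\times n$ matrix, $\nu$ is a Borel measure on $\mathbb{R}^n$ with $\nu(\{0\})=0$ and $\int_{\mathbb{R}^n}(1\wedge\|x\|^2)\,\nu(dx)<\infty$, and $$\mathbf{E}\,e^{i\langle \xi,X_t\rangle}=e^{-t\Psi(\xi)}\qquad(t\ge 0,\ \xi\in\mathbb{R}^n),$$ where the characteristic exponent $\Psi$ is $$\Psi(\xi)=i\langle b,\xi\rangle+\tfrac12\langle \xi,Q\xi\rangle+\int_{\mathbb{R}^n}\bigl(1-e^{i\langle\xi,x\rangle}+i\langle\xi,x\rangle\mathbf{1}_{\{\|x\|\le 1\}}\bigr)\,\nu(dx).$$ Let $\beta_0\in(0,1)$ and $t>0$. Then the following are equivalent: 1. $\mathbf{E}\bigl(\|X_t\|^{\beta_0}\bigr)<\infty$; 2. $\int_{\{\|x\|>1\}}\|x\|^{\beta_0}\,\nu(dx)<\infty$;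 3. $\int_{\{\|\xi\|\le 1\}}\dfrac{\operatorname{Re}\Psi(\xi)}{\|\xi\|^{n+\beta_0}}\,d\xi<\infty$; 4. $\int_{\{\|\xi\|\le 1\}}\dfrac{|\Psi(\xi)|}{\|\xi\|^{n+\beta_0}}\,d\xi<\infty$. In particular, if $\int_{\{\|\xi\|\le 1\}}|\Psi(\xi)|\,\|\xi\|^{-n-\beta_0}\,d\xi<\infty$, then all four conditions hold. -/

import Mathlib

open MeasureTheory ProbabilityTheory Filter Topology
open scoped NNReal ENNReal

noncomputable section

/-- A path `x : [0, ∞) → E` is càdlàg: right-continuous with left limits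
(at time `0` the left limit condition is void, since `𝓝[<] 0 = ⊥` in `ℝ≥0`). -/
def IsCadlag {E : Type*} [TopologicalSpace E] (x : ℝ≥0 → E) : Prop :=
  ∀ t : ℝ≥0, ContinuousWithinAt x (Set.Ici t) t ∧ ∃ l : E, Tendsto x (𝓝[<] t) (𝓝 l)

/-- A Lévy process on `ℝⁿ`, defined on the probability space `(Ω, P)`. -/
structure IsLevyProcess {Ω : Type*} [MeasurableSpace Ω] {n : ℕ}
    (X : ℝ≥0 → Ω → EuclideanSpace ℝ (Fin n)) (P : Measure Ω) : Prop where
  measurable : ∀ t, Measurable (X t)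
  zero : ∀ᵐ ω ∂P, X 0 ω = 0
  cadlag : ∀ᵐ ω ∂P, IsCadlag fun t => X t ω
  stationary : ∀ s h : ℝ≥0,
    IdentDistrib (fun ω => X (s + h) ω - X s ω) (fun ω => X h ω - X 0 ω) P P
  indep : HasIndepIncrements X P

/-- A Lévy measure on `ℝⁿ`: no mass at the origin, and `∫ (1 ∧ ‖x‖²) ν(dx) < ∞`. -/
structure IsLevyMeasure {n : ℕ} (ν : Measure (EuclideanSpace ℝ (Fin n))) : Prop where
  zero : ν {0} = 0
  integrable : ∫⁻ x, ENNReal.ofReal (min 1 (‖x‖ ^ 2)) ∂ν < ∞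

/-- The Lévy–Khintchine exponent with drift vector `b`, Gaussian covariance matrix `Q` and Lévy
measure `ν`:
`Ψ(ξ) = i⟨b, ξ⟩ + ½⟨ξ, Qξ⟩ + ∫ (1 - exp(i⟨ξ, x⟩) + i⟨ξ, x⟩ 1_{‖x‖ ≤ 1}) ν(dx)`. -/
def levyExponent {n : ℕ} (b : EuclideanSpace ℝ (Fin n)) (Q : Matrix (Fin n) (Fin n) ℝ)
    (ν : Measure (EuclideanSpace ℝ (Fin n))) (ξ : EuclideanSpace ℝ (Fin n)) : ℂ :=
  Complex.I * (inner ℝ b ξ : ℝ)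
    + (1 / 2 : ℂ) * ((ξ.ofLp ⬝ᵥ Q.mulVec ξ.ofLp : ℝ) : ℂ)
    + ∫ x, (1 - Complex.exp (Complex.I * (inner ℝ ξ x : ℝ))
        + Set.indicator {y : EuclideanSpace ℝ (Fin n) | ‖y‖ ≤ 1}
            (fun y => Complex.I * (inner ℝ ξ y : ℝ)) x) ∂ν

/-- `(b, Q, ν)` is the characteristic triplet of the process `X`: the matrix `Q` is symmetric and
positive semidefinite, `ν` is a Lévy measure, and `E exp(i⟨ξ, X_t⟩) = exp(-t Ψ(ξ))` for all `t`
and `ξ`, where `Ψ` is the exponent of the triplet. -/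
structure IsCharacteristicTriplet {Ω : Type*} [MeasurableSpace Ω] {n : ℕ}
    (X : ℝ≥0 → Ω → EuclideanSpace ℝ (Fin n)) (P : Measure Ω)
    (b : EuclideanSpace ℝ (Fin n)) (Q : Matrix (Fin n) (Fin n) ℝ)
    (ν : Measure (EuclideanSpace ℝ (Fin n))) : Prop where
  posSemidef : Q.PosSemidef
  levyMeasure : IsLevyMeasure ν
  charFun_eq : ∀ (t : ℝ≥0) (ξ : EuclideanSpace ℝ (Fin n)),
    ∫ ω, Complex.exp (Complex.I * (inner ℝ ξ (X t ω) : ℝ)) ∂P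
      = Complex.exp (-((t : ℝ) : ℂ) * levyExponent b Q ν ξ)

end

/-! Everything is a comparison between `β`-moments of a measure and the size of one minus its
characteristic function near 0. By scaling, `min 2 (‖ξ‖ * ‖x‖)`, which dominates `|1 - exp(i⟨ξ,
x⟩)|`, integrates against `‖ξ‖ ^ (-(n + β))` to a constant times `‖x‖ ^ β`, finite because `0 < β <
1`. Conversely, for `‖x‖ > 1` the integral of `1 - cos⟨ξ, x⟩` over the unit ball is at least a
positive constant times `‖x‖ ^ β`. Tonelli turns both into statements about any s-finite measure.

For `ν`: on the unit ball `Re Ψ` dominates `∫ (1 - cos⟨ξ, x⟩) dν`, while `|Ψ|` is at most `C‖ξ‖`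
plus the large-jump term. This gives 2 → 4 → 3 → 2.

For the law of `X t`, with characteristic function `exp(-tΨ)`: 4 → 1 uses `|1 - exp(-z)| ≤ |z|` for
`Re z ≥ 0`, and 1 → 3 uses the reverse estimate of `Re z` by `|1 - exp(-z)|`, valid while `Re z`
stays bounded. -/

/-- The weight `‖ξ‖ ^ (-(n + β))` as an extended nonnegative function, with value `0` at `0`. -/
noncomputable def radialWeight (n : ℕ) (β : ℝ) (ξ : EuclideanSpace ℝ (Fin n)) : ℝ≥0∞ :=
  ENNReal.ofReal (1 / ‖ξ‖ ^ ((n : ℝ) + β))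

theorem measurable_radialWeight (n : ℕ) (β : ℝ) : Measurable (radialWeight n β) := by
  unfold radialWeight
  fun_prop

/-! ### Integrals against the radial weight -/

/-- Near 0 the integrand is `y ^ (-β)`, integrable as `β < 1`; at infinity it is `2 * y ^ (-1 - β)`,
integrable as `β > 0`. -/
theorem integrableOn_min_mul_rpow {β : ℝ} (h0 : 0 < β) (h1 : β < 1) :
    IntegrableOn (fun y : ℝ => min 2 y * y ^ (-1 - β)) (Set.Ioi 0) := by
  have hm : Measurable (fun y : ℝ => min 2 y * y ^ (-1 - β)) := by fun_prop
  rw [← Set.Ioo_union_Ici_eq_Ioi (zero_lt_one' ℝ), integrableOn_union]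
  constructor
  · have h : IntegrableOn (fun y : ℝ => y ^ (-β)) (Set.Ioo 0 1) := by
      rw [intervalIntegral.integrableOn_Ioo_rpow_iff zero_lt_one]; linarith
    refine Integrable.mono' h hm.aestronglyMeasurable ?_
    refine (ae_restrict_iff' measurableSet_Ioo).2 (ae_of_all _ fun y hy => ?_)
    have hy0 : 0 < y := hy.1
    rw [Real.norm_of_nonneg (by positivity)]
    have : y ^ (-β) = y * y ^ (-1 - β) := by
      conv_rhs => rw [← Real.rpow_one_add' hy0.le (by linarith)]
      congr 1; ring
    rw [this]
    gcongr
    exact min_le_right _ _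
  · rw [integrableOn_Ici_iff_integrableOn_Ioi]
    have h : IntegrableOn (fun y : ℝ => 2 * y ^ (-1 - β)) (Set.Ioi 1) :=
      (integrableOn_Ioi_rpow_of_lt (by linarith) zero_lt_one).const_mul 2
    refine Integrable.mono' h hm.aestronglyMeasurable ?_
    refine (ae_restrict_iff' measurableSet_Ioi).2 (ae_of_all _ fun y hy => ?_)
    have hy0 : 0 < y := zero_lt_one.trans hy
    rw [Real.norm_of_nonneg (by positivity)]
    gcongr
    exact min_le_left _ _

theorem integrable_min_norm_div_rpow (n : ℕ) {β : ℝ} (h0 : 0 < β) (h1 : β < 1) :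
    Integrable (fun ξ : EuclideanSpace ℝ (Fin n) => min 2 ‖ξ‖ * (1 / ‖ξ‖ ^ ((n : ℝ) + β))) := by
  rcases Nat.eq_zero_or_pos n with rfl | hn
  · have : (fun ξ : EuclideanSpace ℝ (Fin 0) => min 2 ‖ξ‖ * (1 / ‖ξ‖ ^ (((0 : ℕ) : ℝ) + β)))
        = fun _ => 0 := by
      funext ξ
      simp [Subsingleton.elim ξ 0]
    rw [this]
    exact integrable_zero _ _ _
  · have : Nonempty (Fin n) := ⟨⟨0, hn⟩⟩
    rw [integrable_fun_norm_addHaar volume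
      (f := fun y : ℝ => min 2 y * (1 / y ^ ((n : ℝ) + β)))]
    refine (integrableOn_min_mul_rpow h0 h1).congr_fun (fun y hy => ?_) measurableSet_Ioi
    have hy0 : (0 : ℝ) < y := hy
    simp only [finrank_euclideanSpace, Fintype.card_fin, smul_eq_mul]
    rw [one_div, ← Real.rpow_neg hy0.le, mul_left_comm, ← Real.rpow_natCast,
      ← Real.rpow_add hy0, Nat.cast_sub hn]
    congr 2
    push_cast
    ring

theorem lintegral_min_norm_mul_radialWeight_lt_top (n : ℕ) {β : ℝ} (h0 : 0 < β) (h1 : β < 1) :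
    ∫⁻ ξ, ENNReal.ofReal (min 2 ‖ξ‖) * radialWeight n β ξ < ∞ := by
  have h := (integrable_min_norm_div_rpow n h0 h1).hasFiniteIntegral
  rw [hasFiniteIntegral_iff_ofReal (ae_of_all _ fun ξ => by positivity)] at h
  refine lt_of_eq_of_lt (lintegral_congr fun ξ => ?_) h
  rw [radialWeight, ENNReal.ofReal_mul (by positivity)]

/-- Substitute `r • ξ`: the weight is homogeneous of degree `-(n + β)` and the volume scales by `r ^
n`, leaving `r ^ β`. -/
theorem lintegral_min_mul_norm_mul_radialWeight (n : ℕ) {β : ℝ} (h0 : 0 < β) {r : ℝ}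
    (hr : 0 ≤ r) :
    ∫⁻ ξ, ENNReal.ofReal (min 2 (‖ξ‖ * r)) * radialWeight n β ξ
      = ENNReal.ofReal (r ^ β) * ∫⁻ ξ, ENNReal.ofReal (min 2 ‖ξ‖) * radialWeight n β ξ := by
  rcases hr.eq_or_lt with rfl | hr
  · simp [Real.zero_rpow h0.ne']
  have hf : Measurable fun ξ : EuclideanSpace ℝ (Fin n) =>
      ENNReal.ofReal (min 2 ‖ξ‖) * radialWeight n β ξ :=
    Measurable.mul (by fun_prop) (measurable_radialWeight n β)
  have hmap := lintegral_map (μ := (volume : Measure (EuclideanSpace ℝ (Fin n)))) hf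
    (measurable_const_smul r)
  rw [Measure.map_addHaar_smul _ hr.ne', lintegral_smul_measure] at hmap
  have hscale : ∀ ξ : EuclideanSpace ℝ (Fin n),
      ENNReal.ofReal (min 2 (‖ξ‖ * r)) * radialWeight n β ξ
        = ENNReal.ofReal (r ^ ((n : ℝ) + β)) *
          (ENNReal.ofReal (min 2 ‖r • ξ‖) * radialWeight n β (r • ξ)) := by
    intro ξ
    simp only [radialWeight, norm_smul, Real.norm_of_nonneg hr.le]
    rw [← ENNReal.ofReal_mul (by positivity), ← ENNReal.ofReal_mul (by positivity),
      ← ENNReal.ofReal_mul (by positivity), Real.mul_rpow hr.le (norm_nonneg _), mul_comm r]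
    congr 1
    have : r ^ ((n : ℝ) + β) ≠ 0 := (Real.rpow_pos_of_pos hr _).ne'
    field_simp
  simp_rw [hscale]
  rw [lintegral_const_mul' _ _ ENNReal.ofReal_ne_top, ← hmap, smul_eq_mul, ← mul_assoc,
    ← ENNReal.ofReal_mul (by positivity)]
  congr 2
  rw [finrank_euclideanSpace, Fintype.card_fin, abs_of_pos (by positivity),
    Real.rpow_add hr, Real.rpow_natCast]
  field_simp

/-- It suffices to integrate over a ball of radius `1 / (4r)`, of volume of order `r ^ (-n)`, on
which the cosine stays away from 1 and the weight is at least `r ^ (n + β)`. -/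
theorem ofReal_norm_rpow_mul_le_setLIntegral (n : ℕ) {β : ℝ} (h0 : 0 < β)
    {x : EuclideanSpace ℝ (Fin n)} (hx : 1 < ‖x‖) :
    ENNReal.ofReal (1 - Real.cos (1 / 2))
        * volume (Metric.ball (0 : EuclideanSpace ℝ (Fin n)) (1 / 4)) * ENNReal.ofReal (‖x‖ ^ β)
      ≤ ∫⁻ ξ in {ξ | ‖ξ‖ ≤ 1},
          ENNReal.ofReal (1 - Real.cos (inner ℝ ξ x)) * radialWeight n β ξ := by
  set r := ‖x‖ with hr
  have hr0 : 0 < r := zero_lt_one.trans hx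
  -- Centre chosen so that `⟨c, x⟩ = 3/4`; moving by `1 / (4r)` keeps the inner product in `[1/2,
  -- 1]` and the norm at most `1/r`.
  set c : EuclideanSpace ℝ (Fin n) := (3 / (4 * r ^ 2)) • x with hc
  have hcn : ‖c‖ = 3 / (4 * r) := by
    rw [hc, norm_smul, Real.norm_of_nonneg (by positivity), ← hr]
    field_simp
  have hci : inner ℝ c x = 3 / 4 := by
    rw [hc, real_inner_smul_left, real_inner_self_eq_norm_sq, ← hr]
    field_simp
  have hvol : volume (Metric.ball c (r⁻¹ * (1 / 4)))
      = ENNReal.ofReal (r⁻¹ ^ n) * volume (Metric.ball (0 : EuclideanSpace ℝ (Fin n)) (1 / 4)) := by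
    rw [Measure.addHaar_ball_mul_of_pos _ _ (inv_pos.2 hr0), finrank_euclideanSpace,
      Fintype.card_fin]
  have key : ∀ ξ ∈ Metric.ball c (r⁻¹ * (1 / 4)), ‖ξ‖ ≤ r⁻¹ ∧ 1 / 2 ≤ inner ℝ ξ x ∧
      inner ℝ ξ x ≤ 1 := by
    intro ξ hξ
    rw [mem_ball_iff_norm] at hξ
    have e1 : ‖ξ‖ ≤ r⁻¹ := by
      have h := norm_add_le (ξ - c) c
      rw [sub_add_cancel, hcn] at h
      have : r⁻¹ * (1 / 4) + 3 / (4 * r) = r⁻¹ := by field_simp; norm_num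
      linarith
    have e2 : |inner ℝ (ξ - c) x| ≤ 1 / 4 := by
      refine (abs_real_inner_le_norm _ _).trans ?_
      rw [← hr]
      calc ‖ξ - c‖ * r ≤ (r⁻¹ * (1 / 4)) * r := by gcongr
        _ = 1 / 4 := by field_simp
    rw [inner_sub_left, hci, abs_le] at e2
    exact ⟨e1, by linarith, by linarith⟩
  have hsub : Metric.ball c (r⁻¹ * (1 / 4)) ⊆ {ξ | ‖ξ‖ ≤ 1} := fun ξ hξ =>
    (key ξ hξ).1.trans (inv_le_one_of_one_le₀ hx.le)
  calc _ = ∫⁻ _ in Metric.ball c (r⁻¹ * (1 / 4)),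
        ENNReal.ofReal (1 - Real.cos (1 / 2)) * ENNReal.ofReal (r ^ ((n : ℝ) + β)) := by
        rw [setLIntegral_const, hvol, Real.rpow_add hr0, Real.rpow_natCast, mul_right_comm,
          mul_assoc, mul_assoc, ← mul_assoc (ENNReal.ofReal (r ^ n * r ^ β)),
          ← ENNReal.ofReal_mul (by positivity)]
        congr 4
        rw [inv_pow]
        field_simp
    _ ≤ ∫⁻ ξ in Metric.ball c (r⁻¹ * (1 / 4)),
        ENNReal.ofReal (1 - Real.cos (inner ℝ ξ x)) * radialWeight n β ξ := by
        refine setLIntegral_mono' measurableSet_ball fun ξ hξ => ?_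
        obtain ⟨e1, e2, e3⟩ := key ξ hξ
        -- The origin must be excluded, since the weight takes the default value 0 there.
        have hξ0 : 0 < ‖ξ‖ := by
          rw [norm_pos_iff]
          rintro rfl
          rw [inner_zero_left] at e2
          norm_num at e2
        unfold radialWeight
        gcongr
        · exact Real.cos_le_cos_of_nonneg_of_le_pi (by norm_num)
            (by linarith [Real.pi_gt_three]) e2
        · rw [one_div, ← Real.inv_rpow hξ0.le]
          gcongr
          exact (le_inv_comm₀ hr0 hξ0).2 e1
    _ ≤ _ := lintegral_mono_set hsub

theorem measure_ball_quarter_mul_ne_zero (n : ℕ) :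
    ENNReal.ofReal (1 - Real.cos (1 / 2)) *
      volume (Metric.ball (0 : EuclideanSpace ℝ (Fin n)) (1 / 4)) ≠ 0 := by
  refine mul_ne_zero ?_ (Metric.measure_ball_pos _ _ (by norm_num)).ne'
  rw [ENNReal.ofReal_ne_zero_iff, sub_pos]
  nth_rw 2 [← Real.cos_zero]
  exact Real.cos_lt_cos_of_nonneg_of_le_pi le_rfl (by linarith [Real.pi_gt_three]) (by norm_num)

/-! ### Moments of a measure via Tonelli -/

theorem setLIntegral_norm_rpow_lt_top {Ω : Type*} [MeasurableSpace Ω] (μ : Measure Ω) [SFinite μ]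
    {n : ℕ} {Y : Ω → EuclideanSpace ℝ (Fin n)} (hY : Measurable Y) {β : ℝ} (h0 : 0 < β)
    (h : ∫⁻ ξ in {ξ | ‖ξ‖ ≤ 1}, (∫⁻ ω, ENNReal.ofReal (1 - Real.cos (inner ℝ ξ (Y ω))) ∂μ)
      * radialWeight n β ξ < ∞) :
    ∫⁻ ω in {ω | 1 < ‖Y ω‖}, ENNReal.ofReal (‖Y ω‖ ^ β) ∂μ < ∞ := by
  have hS : MeasurableSet {ω | 1 < ‖Y ω‖} := measurableSet_lt measurable_const hY.norm
  set C := ENNReal.ofReal (1 - Real.cos (1 / 2)) *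
      volume (Metric.ball (0 : EuclideanSpace ℝ (Fin n)) (1 / 4)) with hC
  have hw := measurable_radialWeight n β
  have hle : C * ∫⁻ ω in {ω | 1 < ‖Y ω‖}, ENNReal.ofReal (‖Y ω‖ ^ β) ∂μ < ∞ := by
    rw [← lintegral_const_mul _ (by fun_prop)]
    refine lt_of_le_of_lt ?_ h
    calc _ ≤ ∫⁻ ω in {ω | 1 < ‖Y ω‖}, (∫⁻ ξ in {ξ | ‖ξ‖ ≤ 1},
          ENNReal.ofReal (1 - Real.cos (inner ℝ ξ (Y ω))) * radialWeight n β ξ) ∂μ :=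
          setLIntegral_mono' hS fun ω hω => ofReal_norm_rpow_mul_le_setLIntegral n h0 hω
      _ ≤ ∫⁻ ω, (∫⁻ ξ in {ξ | ‖ξ‖ ≤ 1},
          ENNReal.ofReal (1 - Real.cos (inner ℝ ξ (Y ω))) * radialWeight n β ξ) ∂μ :=
          setLIntegral_le_lintegral _ _
      _ = ∫⁻ ξ in {ξ | ‖ξ‖ ≤ 1}, ∫⁻ ω,
          ENNReal.ofReal (1 - Real.cos (inner ℝ ξ (Y ω))) * radialWeight n β ξ ∂μ :=
          lintegral_lintegral_swap (by fun_prop)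
      _ = _ := by
          refine lintegral_congr fun ξ => ?_
          rw [lintegral_mul_const _ (by fun_prop)]
  by_contra hcon
  rw [not_lt_top_iff] at hcon
  rw [hcon, ENNReal.mul_top (measure_ball_quarter_mul_ne_zero n)] at hle
  exact lt_irrefl _ hle

theorem lintegral_lintegral_min_mul_radialWeight_lt_top {Ω : Type*} [MeasurableSpace Ω]
    (μ : Measure Ω) [SFinite μ] {n : ℕ} {Y : Ω → EuclideanSpace ℝ (Fin n)} (hY : Measurable Y)
    {β : ℝ} (h0 : 0 < β) (h1 : β < 1) (h : ∫⁻ ω, ENNReal.ofReal (‖Y ω‖ ^ β) ∂μ < ∞) :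
    ∫⁻ ξ, (∫⁻ ω, ENNReal.ofReal (min 2 (‖ξ‖ * ‖Y ω‖)) ∂μ) * radialWeight n β ξ < ∞ := by
  have hw := measurable_radialWeight n β
  calc _ = ∫⁻ ξ, ∫⁻ ω, ENNReal.ofReal (min 2 (‖ξ‖ * ‖Y ω‖)) * radialWeight n β ξ ∂μ := by
        refine lintegral_congr fun ξ => ?_
        rw [lintegral_mul_const _ (by fun_prop)]
    _ = ∫⁻ ω, (∫⁻ ξ, ENNReal.ofReal (min 2 (‖ξ‖ * ‖Y ω‖)) * radialWeight n β ξ) ∂μ :=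
        lintegral_lintegral_swap (by fun_prop)
    _ = ∫⁻ ω, ENNReal.ofReal (‖Y ω‖ ^ β) *
          (∫⁻ ξ, ENNReal.ofReal (min 2 ‖ξ‖) * radialWeight n β ξ) ∂μ :=
        lintegral_congr fun ω => lintegral_min_mul_norm_mul_radialWeight n h0 (norm_nonneg _)
    _ = (∫⁻ ω, ENNReal.ofReal (‖Y ω‖ ^ β) ∂μ) *
          ∫⁻ ξ, ENNReal.ofReal (min 2 ‖ξ‖) * radialWeight n β ξ :=
        lintegral_mul_const _ (by fun_prop)
    _ < ∞ := ENNReal.mul_lt_top h (lintegral_min_norm_mul_radialWeight_lt_top n h0 h1)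

/-! ### Estimates for the Lévy–Khintchine exponent -/

/-- The integrand of the jump part of the Lévy–Khintchine exponent. -/
noncomputable def levyIntegrand {n : ℕ} (ξ x : EuclideanSpace ℝ (Fin n)) : ℂ :=
  1 - Complex.exp (Complex.I * (inner ℝ ξ x : ℝ))
    + Set.indicator {y : EuclideanSpace ℝ (Fin n) | ‖y‖ ≤ 1}
        (fun y => Complex.I * (inner ℝ ξ y : ℝ)) x

theorem levyExponent_eq {n : ℕ} (b : EuclideanSpace ℝ (Fin n)) (Q : Matrix (Fin n) (Fin n) ℝ)
    (ν : Measure (EuclideanSpace ℝ (Fin n))) (ξ : EuclideanSpace ℝ (Fin n)) :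
    levyExponent b Q ν ξ = Complex.I * (inner ℝ b ξ : ℝ)
      + (1 / 2 : ℂ) * ((ξ.ofLp ⬝ᵥ Q.mulVec ξ.ofLp : ℝ) : ℂ) + ∫ x, levyIntegrand ξ x ∂ν :=
  rfl

theorem norm_one_sub_exp_I_mul_le (y : ℝ) :
    ‖1 - Complex.exp (Complex.I * y)‖ ≤ min 2 |y| := by
  refine le_min ?_ ?_
  · refine (norm_sub_le _ _).trans ?_
    rw [mul_comm, Complex.norm_exp_ofReal_mul_I, norm_one]
    norm_num
  · rw [norm_sub_rev]
    exact Real.norm_exp_I_mul_ofReal_sub_one_le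

theorem norm_one_sub_exp_I_mul_inner_le {n : ℕ} (ξ x : EuclideanSpace ℝ (Fin n)) :
    ‖1 - Complex.exp (Complex.I * (inner ℝ ξ x : ℝ))‖ ≤ min 2 (‖ξ‖ * ‖x‖) :=
  (norm_one_sub_exp_I_mul_le _).trans (min_le_min_left _ (abs_real_inner_le_norm _ _))

theorem one_sub_exp_I_mul_re (y : ℝ) :
    (1 - Complex.exp (Complex.I * y)).re = 1 - Real.cos y := by
  rw [mul_comm, Complex.sub_re, Complex.one_re, Complex.exp_ofReal_mul_I_re]

theorem levyIntegrand_re {n : ℕ} (ξ x : EuclideanSpace ℝ (Fin n)) :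
    (levyIntegrand ξ x).re = 1 - Real.cos (inner ℝ ξ x) := by
  rw [levyIntegrand, Complex.add_re, one_sub_exp_I_mul_re]
  by_cases hx : x ∈ {y : EuclideanSpace ℝ (Fin n) | ‖y‖ ≤ 1} <;> simp [hx]

/-- Second-order Taylor bound for `exp`; one factor `‖ξ‖ ≤ 1` is discarded so that small jumps get
the same linear bound as the drift. -/
theorem norm_levyIntegrand_le_of_norm_le_one {n : ℕ} {ξ x : EuclideanSpace ℝ (Fin n)}
    (hξ : ‖ξ‖ ≤ 1) (hx : ‖x‖ ≤ 1) : ‖levyIntegrand ξ x‖ ≤ ‖ξ‖ * ‖x‖ ^ 2 := by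
  have hle : |(inner ℝ ξ x : ℝ)| ≤ ‖ξ‖ * ‖x‖ := abs_real_inner_le_norm _ _
  have hnorm : ‖Complex.I * (inner ℝ ξ x : ℝ)‖ = |(inner ℝ ξ x : ℝ)| := by simp
  have h1 : ‖Complex.I * (inner ℝ ξ x : ℝ)‖ ≤ 1 := by
    rw [hnorm]
    exact hle.trans (mul_le_one₀ hξ (norm_nonneg _) hx)
  have h2 := Complex.norm_exp_sub_one_sub_id_le h1
  have h3 : levyIntegrand ξ x = -(Complex.exp (Complex.I * (inner ℝ ξ x : ℝ)) - 1
      - Complex.I * (inner ℝ ξ x : ℝ)) := by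
    rw [levyIntegrand, Set.indicator_of_mem (by exact hx)]
    ring
  rw [h3, norm_neg]
  refine h2.trans ?_
  rw [hnorm]
  calc |(inner ℝ ξ x : ℝ)| ^ 2 ≤ (‖ξ‖ * ‖x‖) ^ 2 := by gcongr
    _ = ‖ξ‖ * (‖ξ‖ * ‖x‖ ^ 2) := by ring
    _ ≤ ‖ξ‖ * (1 * ‖x‖ ^ 2) := by gcongr
    _ = _ := by ring

theorem norm_levyIntegrand_le_of_one_lt_norm {n : ℕ} {ξ x : EuclideanSpace ℝ (Fin n)}
    (hx : 1 < ‖x‖) : ‖levyIntegrand ξ x‖ ≤ min 2 (‖ξ‖ * ‖x‖) := by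
  rw [levyIntegrand, Set.indicator_of_notMem (by simpa using hx), add_zero]
  exact norm_one_sub_exp_I_mul_inner_le ξ x

theorem measurable_uncurry_levyIntegrand (n : ℕ) :
    Measurable (Function.uncurry (levyIntegrand (n := n))) := by
  have h : Function.uncurry (levyIntegrand (n := n)) = fun p =>
      1 - Complex.exp (Complex.I * (inner ℝ p.1 p.2 : ℝ))
      + Set.indicator {q : EuclideanSpace ℝ (Fin n) × EuclideanSpace ℝ (Fin n) | ‖q.2‖ ≤ 1}
          (fun q => Complex.I * (inner ℝ q.1 q.2 : ℝ)) p := by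
    funext p
    simp only [Function.uncurry, levyIntegrand, Set.indicator, Set.mem_ofPred_eq]
  rw [h]
  refine Measurable.add (by fun_prop) (Measurable.indicator (by fun_prop) ?_)
  exact measurableSet_le (by fun_prop) measurable_const

theorem measurable_levyIntegrand {n : ℕ} (ξ : EuclideanSpace ℝ (Fin n)) :
    Measurable (levyIntegrand ξ) :=
  (measurable_uncurry_levyIntegrand n).of_uncurry_left

namespace IsLevyMeasure

variable {n : ℕ} {ν : Measure (EuclideanSpace ℝ (Fin n))}

/-- Needed for Tonelli. By Markov, `ν` is finite on superlevel sets of `1 ∧ ‖x‖²`; these miss only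
the origin, which is null. -/
theorem sigmaFinite (hν : IsLevyMeasure ν) : SigmaFinite ν := by
  let f : EuclideanSpace ℝ (Fin n) → ℝ≥0∞ := fun x => ENNReal.ofReal (min 1 (‖x‖ ^ 2))
  have hf : Measurable f := by fun_prop
  refine Measure.sigmaFinite_of_countable
    (S := insert {0} (Set.range fun k : ℕ => {x | ((k : ℝ≥0∞) + 1)⁻¹ ≤ f x}))
    ((Set.countable_range _).insert _) ?_ ?_
  · rintro s (rfl | ⟨k, rfl⟩)
    · rw [hν.zero]; exact ENNReal.zero_lt_top
    · have hk : ((k : ℝ≥0∞) + 1)⁻¹ ≠ 0 := ENNReal.inv_ne_zero.2 (by finiteness)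
      exact (meas_ge_le_lintegral_div hf.aemeasurable hk (by simp)).trans_lt
        (ENNReal.div_lt_top hν.integrable.ne hk)
  · refine Set.eq_univ_of_forall fun x => ?_
    by_cases hx : x = 0
    · exact ⟨{0}, Set.mem_insert _ _, hx⟩
    · have hfx : f x ≠ 0 := by
        have : 0 < ‖x‖ := norm_pos_iff.2 hx
        exact (ENNReal.ofReal_pos.2 (by positivity)).ne'
      obtain ⟨k, hk⟩ := ENNReal.exists_inv_nat_lt hfx
      refine ⟨_, Set.mem_insert_of_mem _ ⟨k, rfl⟩, ?_⟩
      exact (ENNReal.inv_le_inv.2 le_self_add).trans hk.le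

theorem integrable_min_one_norm_sq (hν : IsLevyMeasure ν) :
    Integrable (fun x => min 1 (‖x‖ ^ 2)) ν := by
  refine ⟨by fun_prop, ?_⟩
  rw [hasFiniteIntegral_iff_ofReal (ae_of_all _ fun x => by positivity)]
  exact hν.integrable

theorem integrable_levyIntegrand (hν : IsLevyMeasure ν) {ξ : EuclideanSpace ℝ (Fin n)}
    (hξ : ‖ξ‖ ≤ 1) : Integrable (levyIntegrand ξ) ν := by
  refine (hν.integrable_min_one_norm_sq.const_mul 2).mono'
    (measurable_levyIntegrand ξ).aestronglyMeasurable (ae_of_all _ fun x => ?_)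
  rcases le_or_gt ‖x‖ 1 with hx | hx
  · refine (norm_levyIntegrand_le_of_norm_le_one hξ hx).trans ?_
    rw [min_eq_right (pow_le_one₀ (norm_nonneg _) hx)]
    gcongr
    linarith
  · refine (norm_levyIntegrand_le_of_one_lt_norm hx).trans ?_
    rw [min_eq_left (one_le_pow₀ hx.le)]
    linarith [min_le_left 2 (‖ξ‖ * ‖x‖)]

theorem setLIntegral_norm_sq_lt_top (hν : IsLevyMeasure ν) :
    ∫⁻ x in {x | ‖x‖ ≤ 1}, ENNReal.ofReal (‖x‖ ^ 2) ∂ν < ∞ := by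
  refine lt_of_le_of_lt ?_ hν.integrable
  refine le_trans (setLIntegral_mono' (g := fun x => ENNReal.ofReal (min 1 (‖x‖ ^ 2)))
    (measurableSet_le measurable_norm measurable_const) fun x hx => ?_)
    (setLIntegral_le_lintegral _ _)
  rw [min_eq_right (pow_le_one₀ (norm_nonneg _) hx)]

theorem measure_one_lt_norm_lt_top (hν : IsLevyMeasure ν) : ν {x | 1 < ‖x‖} < ∞ := by
  refine lt_of_le_of_lt ?_ hν.integrable
  rw [← setLIntegral_one]
  refine le_trans (setLIntegral_mono' (g := fun x => ENNReal.ofReal (min 1 (‖x‖ ^ 2)))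
    (measurableSet_lt measurable_const measurable_norm) fun x hx => ?_)
    (setLIntegral_le_lintegral _ _)
  rw [min_eq_left (one_le_pow₀ (le_of_lt hx)), ENNReal.ofReal_one]

theorem measurable_levyExponent (hν : IsLevyMeasure ν) (b : EuclideanSpace ℝ (Fin n))
    (Q : Matrix (Fin n) (Fin n) ℝ) : Measurable (levyExponent b Q ν) := by
  have := hν.sigmaFinite
  have h : Measurable fun ξ => ∫ x, levyIntegrand ξ x ∂ν :=
    ((measurable_uncurry_levyIntegrand n).stronglyMeasurable.integral_prod_right).measurable
  have hq : Continuous fun ξ : EuclideanSpace ℝ (Fin n) => ξ.ofLp ⬝ᵥ Q.mulVec ξ.ofLp := by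
    fun_prop
  have hq' := hq.measurable
  change Measurable fun ξ => levyExponent b Q ν ξ
  simp_rw [levyExponent_eq]
  fun_prop

/-- The drift is purely imaginary and the Gaussian part is nonnegative, so dropping both leaves the
jump part. -/
theorem lintegral_one_sub_cos_le_levyExponent_re (hν : IsLevyMeasure ν)
    (b : EuclideanSpace ℝ (Fin n)) {Q : Matrix (Fin n) (Fin n) ℝ} (hQ : Q.PosSemidef)
    {ξ : EuclideanSpace ℝ (Fin n)} (hξ : ‖ξ‖ ≤ 1) :
    0 ≤ (levyExponent b Q ν ξ).re ∧
    ∫⁻ x, ENNReal.ofReal (1 - Real.cos (inner ℝ ξ x)) ∂ν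
      ≤ ENNReal.ofReal (levyExponent b Q ν ξ).re := by
  have hint := hν.integrable_levyIntegrand hξ
  have hre : (∫ x, levyIntegrand ξ x ∂ν).re = ∫ x, (1 - Real.cos (inner ℝ ξ x)) ∂ν := by
    have h : ∫ x, (levyIntegrand ξ x).re ∂ν = (∫ x, levyIntegrand ξ x ∂ν).re := integral_re hint
    simp_rw [← h, levyIntegrand_re]
  have hint' : Integrable (fun x => 1 - Real.cos (inner ℝ ξ x)) ν :=
    hint.re.congr (ae_of_all _ fun x => levyIntegrand_re ξ x)
  have hnn : 0 ≤ fun x => 1 - Real.cos (inner ℝ ξ x) := fun x => sub_nonneg.2 (Real.cos_le_one _)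
  have hq : 0 ≤ ξ.ofLp ⬝ᵥ Q.mulVec ξ.ofLp := by
    simpa using hQ.dotProduct_mulVec_nonneg ξ.ofLp
  have hexp : (levyExponent b Q ν ξ).re
      = 1 / 2 * (ξ.ofLp ⬝ᵥ Q.mulVec ξ.ofLp) + ∫ x, (1 - Real.cos (inner ℝ ξ x)) ∂ν := by
    rw [levyExponent_eq, Complex.add_re, hre, Complex.add_re]
    simp
  have hi := integral_nonneg (μ := ν) hnn
  rw [← ofReal_integral_eq_lintegral_ofReal hint' (ae_of_all _ hnn), hexp]
  exact ⟨by positivity, ENNReal.ofReal_le_ofReal (by linarith)⟩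

/-- Drift, Gaussian part and small jumps are all `O(‖ξ‖)` on the unit ball; only the large jumps
carry moment information. -/
theorem exists_enorm_levyExponent_le (hν : IsLevyMeasure ν) (b : EuclideanSpace ℝ (Fin n))
    (Q : Matrix (Fin n) (Fin n) ℝ) :
    ∃ C : ℝ≥0, ∀ ξ : EuclideanSpace ℝ (Fin n), ‖ξ‖ ≤ 1 → ‖levyExponent b Q ν ξ‖ₑ
      ≤ C * ENNReal.ofReal ‖ξ‖
        + ∫⁻ x in {x | 1 < ‖x‖}, ENNReal.ofReal (min 2 (‖ξ‖ * ‖x‖)) ∂ν := by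
  set T := Matrix.toEuclideanCLM (𝕜 := ℝ) Q with hT
  set J := ∫⁻ x in {x | ‖x‖ ≤ 1}, ENNReal.ofReal (‖x‖ ^ 2) ∂ν with hJ
  have hJtop : J ≠ ∞ := hν.setLIntegral_norm_sq_lt_top.ne
  refine ⟨‖b‖₊ + ‖T‖₊ + J.toNNReal, fun ξ hξ => ?_⟩
  have hb : ‖Complex.I * (inner ℝ b ξ : ℝ)‖ₑ ≤ ‖b‖₊ * ENNReal.ofReal ‖ξ‖ := by
    rw [← enorm_eq_nnnorm, ← ofReal_norm, ← ofReal_norm, ← ENNReal.ofReal_mul (norm_nonneg _)]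
    refine ENNReal.ofReal_le_ofReal ?_
    rw [norm_mul, Complex.norm_I, one_mul, Complex.norm_real]
    exact norm_inner_le_norm _ _
  have hq : ‖(1 / 2 : ℂ) * ((ξ.ofLp ⬝ᵥ Q.mulVec ξ.ofLp : ℝ) : ℂ)‖ₑ
      ≤ ‖T‖₊ * ENNReal.ofReal ‖ξ‖ := by
    rw [← enorm_eq_nnnorm, ← ofReal_norm, ← ofReal_norm, ← ENNReal.ofReal_mul (norm_nonneg _)]
    refine ENNReal.ofReal_le_ofReal ?_
    have hin : ξ.ofLp ⬝ᵥ Q.mulVec ξ.ofLp = inner ℝ (T ξ) ξ := by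
      rw [EuclideanSpace.inner_eq_star_dotProduct, hT, Matrix.ofLp_toEuclideanCLM]
      simp
    rw [hin, norm_mul, Complex.norm_real]
    calc _ ≤ 1 * (‖T ξ‖ * ‖ξ‖) := by
          gcongr
          · norm_num
          · exact norm_inner_le_norm _ _
      _ ≤ 1 * ((‖T‖ * ‖ξ‖) * 1) := by
          gcongr
          exact T.le_opNorm ξ
      _ = _ := by ring
  have hS : MeasurableSet {x : EuclideanSpace ℝ (Fin n) | ‖x‖ ≤ 1} :=
    measurableSet_le measurable_norm measurable_const
  have hcompl : {x : EuclideanSpace ℝ (Fin n) | ‖x‖ ≤ 1}ᶜ = {x | 1 < ‖x‖} := by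
    ext x; simp
  have hg : ‖∫ x, levyIntegrand ξ x ∂ν‖ₑ ≤ J.toNNReal * ENNReal.ofReal ‖ξ‖
      + ∫⁻ x in {x | 1 < ‖x‖}, ENNReal.ofReal (min 2 (‖ξ‖ * ‖x‖)) ∂ν := by
    refine (enorm_integral_le_lintegral_enorm _).trans ?_
    rw [← lintegral_add_compl _ hS, hcompl]
    gcongr ?_ + ?_
    · rw [ENNReal.coe_toNNReal hJtop, hJ, ← lintegral_mul_const _ (by fun_prop)]
      refine setLIntegral_mono' hS fun x hx => ?_
      rw [← ofReal_norm, ← ENNReal.ofReal_mul (by positivity), mul_comm]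
      exact ENNReal.ofReal_le_ofReal (norm_levyIntegrand_le_of_norm_le_one hξ hx)
    · refine setLIntegral_mono' (measurableSet_lt measurable_const measurable_norm) fun x hx => ?_
      rw [← ofReal_norm]
      exact ENNReal.ofReal_le_ofReal (norm_levyIntegrand_le_of_one_lt_norm hx)
  rw [levyExponent_eq]
  calc _ ≤ _ := (enorm_add_le _ _).trans (add_le_add_left (enorm_add_le _ _) _)
    _ ≤ _ := add_le_add (add_le_add hb hq) hg
    _ = _ := by push_cast; ring

theorem exists_norm_levyExponent_le (hν : IsLevyMeasure ν) (b : EuclideanSpace ℝ (Fin n))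
    (Q : Matrix (Fin n) (Fin n) ℝ) :
    ∃ M : ℝ≥0, ∀ ξ : EuclideanSpace ℝ (Fin n), ‖ξ‖ ≤ 1 → ‖levyExponent b Q ν ξ‖ ≤ M := by
  obtain ⟨C, hC⟩ := hν.exists_enorm_levyExponent_le b Q
  have hfin := hν.measure_one_lt_norm_lt_top
  refine ⟨C + 2 * (ν {x | 1 < ‖x‖}).toNNReal, fun ξ hξ => ?_⟩
  rw [← coe_nnnorm, NNReal.coe_le_coe, ← ENNReal.coe_le_coe, ← enorm_eq_nnnorm]
  refine (hC ξ hξ).trans ?_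
  push_cast
  rw [ENNReal.coe_toNNReal hfin.ne]
  gcongr ?_ + ?_
  · calc _ ≤ (C : ℝ≥0∞) * ENNReal.ofReal 1 := by gcongr
      _ = C := by simp
  · rw [← setLIntegral_const]
    refine lintegral_mono fun x => ?_
    calc _ ≤ ENNReal.ofReal 2 := ENNReal.ofReal_le_ofReal (min_le_left _ _)
      _ = 2 := by simp

end IsLevyMeasure

/-! ### From the exponent to the characteristic function -/

theorem integrableOn_div_norm_rpow_iff {n : ℕ} {β : ℝ} {f : EuclideanSpace ℝ (Fin n) → ℝ}
    (hf : Measurable f) (hf0 : ∀ ξ, ‖ξ‖ ≤ 1 → 0 ≤ f ξ) :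
    IntegrableOn (fun ξ => f ξ / ‖ξ‖ ^ ((n : ℝ) + β)) {ξ | ‖ξ‖ ≤ 1} volume
      ↔ ∫⁻ ξ in {ξ | ‖ξ‖ ≤ 1}, ENNReal.ofReal (f ξ) * radialWeight n β ξ < ∞ := by
  have hS : MeasurableSet {x : EuclideanSpace ℝ (Fin n) | ‖x‖ ≤ 1} :=
    measurableSet_le measurable_norm measurable_const
  have hm : Measurable fun ξ => f ξ / ‖ξ‖ ^ ((n : ℝ) + β) := by fun_prop
  rw [IntegrableOn, Integrable, and_iff_right hm.aestronglyMeasurable,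
    hasFiniteIntegral_iff_ofReal ((ae_restrict_iff' hS).2 (ae_of_all _ fun ξ hξ =>
      div_nonneg (hf0 ξ hξ) (by positivity)))]
  have : ∫⁻ ξ in {ξ | ‖ξ‖ ≤ 1}, ENNReal.ofReal (f ξ / ‖ξ‖ ^ ((n : ℝ) + β))
      = ∫⁻ ξ in {ξ | ‖ξ‖ ≤ 1}, ENNReal.ofReal (f ξ) * radialWeight n β ξ :=
    setLIntegral_congr_fun hS fun ξ hξ => by
      simp only [radialWeight]
      rw [← ENNReal.ofReal_mul (hf0 ξ hξ), mul_one_div]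
  rw [this]

/-- Mean value inequality for `s ↦ exp(-sz)` on `[0, 1]`, whose derivative is bounded by `‖z‖` since
`Re z ≥ 0`. -/
theorem norm_one_sub_exp_neg_le {z : ℂ} (hz : 0 ≤ z.re) : ‖1 - Complex.exp (-z)‖ ≤ ‖z‖ := by
  have h := Convex.norm_image_sub_le_of_norm_hasDerivWithin_le
    (f := fun s : ℝ => Complex.exp (-(s * z))) (f' := fun s : ℝ => Complex.exp (-(s * z)) * -z)
    (s := Set.Icc 0 1) (x := 0) (y := 1) (C := ‖z‖) ?_ ?_ (convex_Icc _ _) (by simp) (by simp)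
  · rw [norm_sub_rev]
    simpa using h
  · intro s _
    have h1 : HasDerivAt (fun s : ℝ => -((s : ℂ) * z)) (-z) s := by
      simpa using ((Complex.ofRealCLM.hasDerivAt (x := s)).mul_const z).fun_neg
    exact h1.cexp.hasDerivWithinAt
  · intro s hs
    rw [norm_mul, norm_neg, Complex.norm_exp]
    refine mul_le_of_le_one_left (norm_nonneg _) (Real.exp_le_one_iff.2 ?_)
    simpa using mul_nonneg hs.1 hz

/-- From `1 + x ≤ exp x` follows `x ≤ (1 + x)(1 - exp(-x))`, applied to `x = Re z`. -/
theorem re_le_mul_norm_one_sub_exp_neg {z : ℂ} {M : ℝ} (hz : 0 ≤ z.re) (hM : z.re ≤ M) :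
    z.re ≤ (1 + M) * ‖1 - Complex.exp (-z)‖ := by
  have h1 : 1 - Real.exp (-z.re) ≤ ‖1 - Complex.exp (-z)‖ := by
    have h := norm_sub_norm_le (1 : ℂ) (Complex.exp (-z))
    rwa [Complex.norm_exp, norm_one, Complex.neg_re] at h
  have h2 : z.re ≤ (1 + z.re) * (1 - Real.exp (-z.re)) := by
    have h3 : (1 + z.re) * Real.exp (-z.re) ≤ 1 := by
      calc _ ≤ Real.exp z.re * Real.exp (-z.re) := by
            gcongr
            linarith [Real.add_one_le_exp z.re]
        _ = 1 := by rw [← Real.exp_add]; simp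
    linarith
  refine h2.trans (mul_le_mul (by linarith) h1 ?_ (by linarith))
  rw [sub_nonneg, Real.exp_le_one_iff]
  linarith

theorem integrable_norm_rpow_of_setLIntegral {Ω : Type*} [MeasurableSpace Ω] (P : Measure Ω)
    [IsFiniteMeasure P] {n : ℕ} {Y : Ω → EuclideanSpace ℝ (Fin n)} (hY : Measurable Y) {β : ℝ}
    (h0 : 0 < β) (h : ∫⁻ ω in {ω | 1 < ‖Y ω‖}, ENNReal.ofReal (‖Y ω‖ ^ β) ∂P < ∞) :
    Integrable (fun ω => ‖Y ω‖ ^ β) P := by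
  have hS : MeasurableSet {ω | 1 < ‖Y ω‖} := measurableSet_lt measurable_const hY.norm
  refine ⟨Measurable.aestronglyMeasurable (by fun_prop), ?_⟩
  rw [hasFiniteIntegral_iff_ofReal (ae_of_all _ fun x => by positivity),
    ← lintegral_add_compl _ hS]
  refine ENNReal.add_lt_top.2 ⟨h, ?_⟩
  refine lt_of_le_of_lt (setLIntegral_mono' (g := fun _ => 1) hS.compl fun ω hω => ?_) ?_
  · rw [ENNReal.ofReal_le_one]
    exact Real.rpow_le_one (norm_nonneg _) (by simpa using hω) h0.le
  · rw [setLIntegral_one]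
    exact measure_lt_top _ _

section CharFun

variable {Ω : Type*} [MeasurableSpace Ω] (P : Measure Ω) [IsProbabilityMeasure P] {n : ℕ}
  {Y : Ω → EuclideanSpace ℝ (Fin n)}

theorem integrable_exp_I_mul_inner (hY : Measurable Y) (ξ : EuclideanSpace ℝ (Fin n)) :
    Integrable (fun ω => Complex.exp (Complex.I * (inner ℝ ξ (Y ω) : ℝ))) P := by
  refine Integrable.of_bound (C := 1) (by fun_prop) (ae_of_all _ fun ω => ?_)
  rw [mul_comm, Complex.norm_exp_ofReal_mul_I]

theorem integral_one_sub_exp_I_mul_inner (hY : Measurable Y) (ξ : EuclideanSpace ℝ (Fin n)) :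
    ∫ ω, (1 - Complex.exp (Complex.I * (inner ℝ ξ (Y ω) : ℝ))) ∂P
      = 1 - ∫ ω, Complex.exp (Complex.I * (inner ℝ ξ (Y ω) : ℝ)) ∂P := by
  rw [integral_sub (integrable_const _) (integrable_exp_I_mul_inner P hY ξ)]
  simp

theorem lintegral_one_sub_cos_le_norm (hY : Measurable Y) (ξ : EuclideanSpace ℝ (Fin n)) :
    ∫⁻ ω, ENNReal.ofReal (1 - Real.cos (inner ℝ ξ (Y ω))) ∂P
      ≤ ENNReal.ofReal ‖1 - ∫ ω, Complex.exp (Complex.I * (inner ℝ ξ (Y ω) : ℝ)) ∂P‖ := by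
  have hint : Integrable (fun ω => 1 - Complex.exp (Complex.I * (inner ℝ ξ (Y ω) : ℝ))) P :=
    (integrable_const _).sub (integrable_exp_I_mul_inner P hY ξ)
  have hint' : Integrable (fun ω => 1 - Real.cos (inner ℝ ξ (Y ω))) P :=
    hint.re.congr (ae_of_all _ fun ω => one_sub_exp_I_mul_re _)
  have hre : ∫ ω, (1 - Real.cos (inner ℝ ξ (Y ω))) ∂P
      = (∫ ω, (1 - Complex.exp (Complex.I * (inner ℝ ξ (Y ω) : ℝ))) ∂P).re := by
    have h : ∫ ω, (1 - Complex.exp (Complex.I * (inner ℝ ξ (Y ω) : ℝ))).re ∂P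
      = (∫ ω, (1 - Complex.exp (Complex.I * (inner ℝ ξ (Y ω) : ℝ))) ∂P).re := integral_re hint
    simp_rw [← h, one_sub_exp_I_mul_re]
  rw [← ofReal_integral_eq_lintegral_ofReal hint'
    (ae_of_all _ fun ω => sub_nonneg.2 (Real.cos_le_one _)), hre,
    ← integral_one_sub_exp_I_mul_inner P hY]
  exact ENNReal.ofReal_le_ofReal (Complex.re_le_norm _)

theorem ofReal_norm_one_sub_le_lintegral (hY : Measurable Y) (ξ : EuclideanSpace ℝ (Fin n)) :
    ENNReal.ofReal ‖1 - ∫ ω, Complex.exp (Complex.I * (inner ℝ ξ (Y ω) : ℝ)) ∂P‖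
      ≤ ∫⁻ ω, ENNReal.ofReal (min 2 (‖ξ‖ * ‖Y ω‖)) ∂P := by
  rw [← integral_one_sub_exp_I_mul_inner P hY, ofReal_norm]
  refine (enorm_integral_le_lintegral_enorm _).trans (lintegral_mono fun ω => ?_)
  rw [← ofReal_norm]
  exact ENNReal.ofReal_le_ofReal (norm_one_sub_exp_I_mul_inner_le _ _)

end CharFun

/-! ### The equivalences -/

theorem lemma2p2 {Ω : Type*} [MeasurableSpace Ω] (P : Measure Ω) [IsProbabilityMeasure P] (n : ℕ)
    (X : ℝ≥0 → Ω → EuclideanSpace ℝ (Fin n)) (hX : IsLevyProcess X P)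
    (b : EuclideanSpace ℝ (Fin n)) (Q : Matrix (Fin n) (Fin n) ℝ)
    (ν : Measure (EuclideanSpace ℝ (Fin n))) (hΨ : IsCharacteristicTriplet X P b Q ν)
    (β₀ : ℝ) (hβ₀ : β₀ ∈ Set.Ioo (0 : ℝ) 1) (t : ℝ≥0) (ht : 0 < t) :
    List.TFAE [
      Integrable (fun ω => ‖X t ω‖ ^ β₀) P,
      IntegrableOn (fun x => ‖x‖ ^ β₀) {x | 1 < ‖x‖} ν,
      IntegrableOn (fun ξ => (levyExponent b Q ν ξ).re / ‖ξ‖ ^ ((n : ℝ) + β₀))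
        {ξ | ‖ξ‖ ≤ 1} volume,
      IntegrableOn (fun ξ => ‖levyExponent b Q ν ξ‖ / ‖ξ‖ ^ ((n : ℝ) + β₀))
        {ξ | ‖ξ‖ ≤ 1} volume] := by
  obtain ⟨h0, h1⟩ := hβ₀
  have hν := hΨ.levyMeasure
  have hσ := hν.sigmaFinite
  have hmΨ := hν.measurable_levyExponent b Q
  have hw := measurable_radialWeight n β₀
  have hY := hX.measurable t
  have ht' : (0 : ℝ) < t := ht
  have hS : MeasurableSet {x : EuclideanSpace ℝ (Fin n) | ‖x‖ ≤ 1} :=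
    measurableSet_le measurable_norm measurable_const
  have hre := fun ξ hξ => hν.lintegral_one_sub_cos_le_levyExponent_re b hΨ.posSemidef (ξ := ξ) hξ
  have htre : ∀ ξ : EuclideanSpace ℝ (Fin n), ‖ξ‖ ≤ 1 →
      0 ≤ (((t : ℝ) : ℂ) * levyExponent b Q ν ξ).re := fun ξ hξ => by
    rw [Complex.re_ofReal_mul]
    exact mul_nonneg ht'.le (hre ξ hξ).1
  have hφ : ∀ ξ, 1 - ∫ ω, Complex.exp (Complex.I * (inner ℝ ξ (X t ω) : ℝ)) ∂P
      = 1 - Complex.exp (-(((t : ℝ) : ℂ) * levyExponent b Q ν ξ)) := fun ξ => by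
    rw [hΨ.charFun_eq, neg_mul]
  rw [integrableOn_div_norm_rpow_iff (f := fun ξ => (levyExponent b Q ν ξ).re)
      (Complex.measurable_re.comp hmΨ) fun ξ hξ => (hre ξ hξ).1,
    integrableOn_div_norm_rpow_iff hmΨ.norm fun ξ _ => norm_nonneg _]
  tfae_have 2 → 4 := by
    intro h
    have hfin := h.hasFiniteIntegral
    rw [hasFiniteIntegral_iff_ofReal (ae_of_all _ fun x => by positivity)] at hfin
    have hjump := lintegral_lintegral_min_mul_radialWeight_lt_top (ν.restrict {x | 1 < ‖x‖})
      measurable_id h0 h1 hfin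
    obtain ⟨C, hC⟩ := hν.exists_enorm_levyExponent_le b Q
    have hlin : (C : ℝ≥0∞) * ∫⁻ ξ, ENNReal.ofReal (min 2 ‖ξ‖) * radialWeight n β₀ ξ < ∞ :=
      ENNReal.mul_lt_top ENNReal.coe_lt_top (lintegral_min_norm_mul_radialWeight_lt_top n h0 h1)
    refine lt_of_le_of_lt ?_ (ENNReal.add_lt_top.2 ⟨hlin, hjump⟩)
    rw [← lintegral_const_mul _ (by fun_prop), ← lintegral_add_left (by fun_prop)]
    refine le_trans (setLIntegral_mono' hS fun ξ hξ => ?_) (setLIntegral_le_lintegral _ _)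
    -- The cutoff at 2 is inactive on the unit ball, so the linear term is covered by the full-space
    -- integral.
    have hξ2 : min 2 ‖ξ‖ = ‖ξ‖ := min_eq_right (le_trans hξ one_le_two)
    rw [hξ2, ← mul_assoc, ← add_mul, ofReal_norm]
    gcongr
    exact hC ξ hξ
  tfae_have 4 → 3 := by
    refine lt_of_le_of_lt (lintegral_mono fun ξ => ?_)
    gcongr
    exact Complex.re_le_norm _
  tfae_have 3 → 2 := by
    intro h
    refine ⟨Measurable.aestronglyMeasurable (by fun_prop), ?_⟩
    rw [hasFiniteIntegral_iff_ofReal (ae_of_all _ fun x => by positivity)]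
    refine setLIntegral_norm_rpow_lt_top ν measurable_id h0 (lt_of_le_of_lt ?_ h)
    refine setLIntegral_mono' hS fun ξ hξ => ?_
    gcongr
    exact (hre ξ hξ).2
  tfae_have 4 → 1 := by
    intro h
    refine integrable_norm_rpow_of_setLIntegral P hY h0
      (setLIntegral_norm_rpow_lt_top P hY h0 (lt_of_le_of_lt ?_
        (ENNReal.mul_lt_top (ENNReal.ofReal_lt_top (r := t)) h)))
    rw [← lintegral_const_mul _ (by fun_prop)]
    refine setLIntegral_mono' hS fun ξ hξ => ?_
    rw [← mul_assoc, ← ENNReal.ofReal_mul ht'.le]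
    gcongr
    refine (lintegral_one_sub_cos_le_norm P hY ξ).trans (ENNReal.ofReal_le_ofReal ?_)
    rw [hφ]
    refine (norm_one_sub_exp_neg_le (htre ξ hξ)).trans_eq ?_
    rw [norm_mul, Complex.norm_real, Real.norm_of_nonneg ht'.le]
  tfae_have 1 → 3 := by
    intro h
    have hfin := h.hasFiniteIntegral
    rw [hasFiniteIntegral_iff_ofReal (ae_of_all _ fun x => by positivity)] at hfin
    have hmin := lintegral_lintegral_min_mul_radialWeight_lt_top P hY h0 h1 hfin
    obtain ⟨M, hM⟩ := hν.exists_norm_levyExponent_le b Q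
    -- The estimate for `z = tΨ(ξ)`, where `Re z ≤ tM`, divided by `t`.
    set K : ℝ := (1 + t * M) / t with hK
    have hK0 : 0 ≤ K := by positivity
    refine lt_of_le_of_lt ?_ (ENNReal.mul_lt_top (ENNReal.ofReal_lt_top (r := K)) hmin)
    rw [← lintegral_const_mul' _ _ ENNReal.ofReal_ne_top]
    refine le_trans (setLIntegral_mono' hS fun ξ hξ => ?_) (setLIntegral_le_lintegral _ _)
    rw [← mul_assoc]
    gcongr
    refine le_trans ?_ (mul_le_mul_right (ofReal_norm_one_sub_le_lintegral P hY ξ) _)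
    rw [← ENNReal.ofReal_mul hK0, hφ]
    refine ENNReal.ofReal_le_ofReal ?_
    have hbound : (((t : ℝ) : ℂ) * levyExponent b Q ν ξ).re ≤ t * M := by
      rw [Complex.re_ofReal_mul]
      gcongr
      exact (Complex.re_le_norm _).trans (hM ξ hξ)
    have := re_le_mul_norm_one_sub_exp_neg (htre ξ hξ) hbound
    rw [Complex.re_ofReal_mul] at this
    rw [hK, div_mul_eq_mul_div, le_div_iff₀ ht', mul_comm]
    exact this
  tfae_finish
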